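/- All graphs are finite and simple. A graph $G$ is distance hereditary if for every set $S$ of vertices such that the induced subgraph $G[S]$ is connected, and for all $u,v\in S$, the distance between $u$ and $v$ in $G[S]$ equals their distance in $G$. A BDH graph is a bipartite distance hereditary graph. An arborescence is a directed tree with a distinguished vertex, its root, from which there is a directed path to every other vertex; its arc set may be empty. Let $G$ be a bipartite graph with color classes $A$ and $B$. Call $G$ a path/arborescence bipartite graph on $A$ if there exist an arborescence $T$ and a bijection $\xi$ from $A$ to the set of arcs of $T$ such that the vertices in $B$ can be added to $T$ as further arcs between vertices of $T$ (loops and parallel or antiparallel arcs being allowed) in such a way that, in the resulting directed multigraph on $V(T)$ with arc set $\xi(A)\cup B$, for each $b\in B$ the set $\{b\}\cup\{\xi(a) : a\in N_G(b)\}$ is the arc set of a directed circuit, i.e. of a closed directed walk that visits no vertex twice (a single loop, and a pair of antiparallel arcs, are directed circuits). Being a path/arborescence bipartite graph on $B$ is defined in the same way with $A$ and $B$ exchanged, and $G$ is a self-dual path/arborescence bipartite graph if it is a path/arborescence bipartite graph on both $A$ and $B$. **Theorem.** Every connected BDH graph is a self-dual path/arborescence bipartite graph. -/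

import Mathlib

/-- A graph is distance hereditary if the distance function of every connected induced subgraph
is inherited from the whole graph. -/
def IsDistanceHereditary {V : Type*} (G : SimpleGraph V) : Prop :=
  ∀ S : Set V, (G.induce S).Connected → ∀ u v : S, (G.induce S).dist u v = G.dist (u : V) (v : V)

/-- Bipartite distance hereditary graphs. -/
def IsBDH {V : Type*} (G : SimpleGraph V) : Prop :=
  G.IsBipartite ∧ IsDistanceHereditary G

/-- `A` and `B` are the color classes of a bipartite graph `G`: they partition the whole vertex
set, and every edge joins a vertex of `A` to a vertex of `B`. -/
def AreColorClasses {V : Type*} (G : SimpleGraph V) (A B : Set V) : Prop :=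
  IsCompl A B ∧ G.IsBipartiteWith A B

/-- In the directed multigraph with vertex set `W` and arc set `E`, where the arc `e` goes from
`src e` to `tgt e`, the set `S` of arcs is the arc set of a directed circuit: its arcs can be listed
cyclically as `c 0, …, c n` so that each arc ends where the next one starts, and the circuit
visits no vertex twice. Two antiparallel arcs form a circuit, and so does one loop. -/
def IsDirectedCircuit {E W : Type*} (src tgt : E → W) (S : Set E) : Prop :=
  ∃ (n : ℕ) (c : Fin (n + 1) → E),
    Function.Injective (fun i => src (c i)) ∧
    (∀ i, tgt (c i) = src (c (i + 1))) ∧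
    Set.range c = S

/-- The bipartite graph `G` with color classes `A` and `B` is a path/arborescence bipartite graph
on `A`: there are an arborescence `T` with vertex set `W` (a quiver on `W`) and a bijection `ξ` from `A` to the
arcs of `T`, and the vertices in `B` can be added to `T` as further arcs between vertices of `T`,
so that, in the resulting directed multigraph on `W` with arc set `A ∪ B`, each `b ∈ B` together
with its neighbors forms a directed circuit. -/
def IsPathArborescenceOn {V : Type*} (G : SimpleGraph V) (A B : Set V) : Prop :=
  ∃ (W : Type) (_ : Quiver.{0} W) (_ : Quiver.Arborescence W) (ξ : A ≃ Quiver.Total W)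
    (src tgt : V → W),
    (∀ a : A, src a = (ξ a).left ∧ tgt a = (ξ a).right) ∧
    ∀ b ∈ B, IsDirectedCircuit src tgt ({b} ∪ G.neighborSet b)

/-- `G` is a self-dual path/arborescence bipartite graph: it is bipartite, and a path/arborescence
bipartite graph on both of its color classes. -/
def IsSelfDualPathArborescence {V : Type*} (G : SimpleGraph V) : Prop :=
  G.IsBipartite ∧
    ∀ A B : Set V, AreColorClasses G A B →
      IsPathArborescenceOn G A B ∧ IsPathArborescenceOn G B A

/-! A connected BDH graph can be reduced to one vertex by repeatedly deleting a pendant vertex or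
one of two twins, staying connected throughout (`IsBDH.exists_pendant_or_twin`). Such a vertex is
found in the last two distance layers from a root `r`: heredity forces common neighbors into
connected subgraphs (`exists_common_adj`), which makes vertices twins.

Reversing the deletions grows a rooted forest on `A` in which each neighborhood of a vertex of `B`
is a descending path (`HasPathForest`). A pendant vertex of `A` extends one path at its lower end; a
twin in `A` is inserted directly below its partner; a new vertex of `B` receives a one-vertex path
or copies the path of its twin.

Finally a root is added and each forest vertex becomes the arc entering it from its parent.
Descending paths become directed paths, which the elements of `B` close into circuits. The argument
is symmetric in `A` and `B`. -/

namespace SimpleGraph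

/-! ### Distance layers, pendant vertices and twins -/

variable {V : Type*} {G : SimpleGraph V}

/-- Adjacent vertices of a connected bipartite graph lie in consecutive distance layers. -/
theorem IsBipartite.dist_adj (hb : G.IsBipartite) (hc : G.Connected) (r : V) {x y : V}
    (h : G.Adj x y) : G.dist r y = G.dist r x + 1 ∨ G.dist r x = G.dist r y + 1 := by
  have c : G.Coloring Bool := hb.toColoring (by simp)
  obtain ⟨p, hp⟩ := hc.exists_walk_length_eq_dist r x
  obtain ⟨q, hq⟩ := hc.exists_walk_length_eq_dist r y
  have hpe := c.even_length_iff_congr p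
  have hqe := c.even_length_iff_congr q
  rw [hp] at hpe
  rw [hq] at hqe
  have hv := c.valid h
  have hne : G.dist r x ≠ G.dist r y := by
    intro he
    rw [he, hqe] at hpe
    revert hv hpe
    cases c x <;> cases c y <;> cases c r <;> simp
  have h1 := hc.dist_triangle (u := r) (v := x) (w := y)
  have h2 := hc.dist_triangle (u := r) (v := y) (w := x)
  rw [dist_eq_one_iff_adj.2 h] at h1
  rw [dist_eq_one_iff_adj.2 h.symm] at h2
  omega

/-- A vertex set in which one can always step towards `r` induces a connected subgraph. -/
theorem induce_connected_of_descent {T : Set V} {r : V} (hr : r ∈ T) (f : V → ℕ)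
    (hT : ∀ x ∈ T, x ≠ r → ∃ y ∈ T, G.Adj x y ∧ f y < f x) : (G.induce T).Connected := by
  have key : ∀ n, ∀ x (hx : x ∈ T), f x = n → (G.induce T).Reachable ⟨x, hx⟩ ⟨r, hr⟩ := by
    intro n
    induction n using Nat.strong_induction_on with
    | _ n ih =>
      intro x hx hn
      by_cases hxr : x = r
      · subst hxr
        exact Reachable.refl _
      · obtain ⟨y, hy, hxy, hlt⟩ := hT x hx hxr
        have hadj : (G.induce T).Adj ⟨x, hx⟩ ⟨y, hy⟩ := hxy
        exact hadj.reachable.trans (ih _ (hn ▸ hlt) y hy rfl)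
  have : Nonempty T := ⟨⟨r, hr⟩⟩
  exact ⟨fun x y => (key _ x x.2 rfl).trans (key _ y y.2 rfl).symm⟩

/-- In a distance hereditary graph, a connected induced subgraph contains a neighbor of `x` that
is closer to `r`. -/
theorem _root_.IsDistanceHereditary.exists_descent (hG : IsDistanceHereditary G) {S : Set V}
    (hS : (G.induce S).Connected) {r x : V} (hr : r ∈ S) (hx : x ∈ S) (hxr : x ≠ r) :
    ∃ y ∈ S, G.Adj x y ∧ G.dist r y + 1 ≤ G.dist r x := by
  obtain ⟨p, hp⟩ := hS.exists_walk_length_eq_dist ⟨x, hx⟩ ⟨r, hr⟩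
  rw [hG S hS] at hp
  cases p with
  | nil => exact absurd rfl hxr
  | @cons _ y _ h q =>
    refine ⟨y, y.2, h, ?_⟩
    have := dist_le q
    rw [hG S hS] at this
    simp only [Walk.length_cons] at hp
    rw [dist_comm, G.dist_comm (u := r) (v := x), ← hp]
    exact Nat.succ_le_succ this

/-- Two nonadjacent vertices with a common neighbor have a common neighbor in every connected
induced subgraph of a distance hereditary graph that contains them. -/
theorem _root_.IsDistanceHereditary.exists_common_adj (hG : IsDistanceHereditary G) {T : Set V}
    (hT : (G.induce T).Connected) {u v x : V} (hu : u ∈ T) (hv : v ∈ T) (huv : u ≠ v)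
    (hn : ¬ G.Adj u v) (hux : G.Adj u x) (hxv : G.Adj x v) :
    ∃ t ∈ T, G.Adj u t ∧ G.Adj t v := by
  obtain ⟨p, hp⟩ := hT.exists_walk_length_eq_dist ⟨u, hu⟩ ⟨v, hv⟩
  rw [hG T hT] at hp
  have hle : G.dist u v ≤ 2 := dist_le (Walk.cons hux (Walk.cons hxv Walk.nil))
  cases p with
  | nil => exact absurd rfl huv
  | @cons _ y _ h q =>
    cases q with
    | nil => exact absurd h hn
    | @cons _ z _ h' q' =>
      cases q' with
      | nil => exact ⟨y, y.2, h, h'⟩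
      | cons h'' q'' =>
        simp only [Walk.length_cons] at hp
        change _ = G.dist u v at hp
        omega

/-- The last vertex added in a connected bipartite distance hereditary graph: a connected induced
subgraph with two or more vertices has a pendant vertex, or a vertex with a twin, whose removal
leaves it connected. -/
theorem _root_.IsBDH.exists_pendant_or_twin [Finite V] (hc : G.Connected) (hG : IsBDH G)
    {S : Set V} (hS : (G.induce S).Connected) (hS2 : S.Nontrivial) :
    ∃ v ∈ S, ∃ u ∈ S, v ≠ u ∧ (G.induce (S \ {v})).Connected ∧
      ((∀ w ∈ S, G.Adj v w ↔ w = u) ∨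
        ((∃ t ∈ S, G.Adj u t ∧ G.Adj v t) ∧ ∀ w ∈ S, G.Adj v w ↔ G.Adj u w)) := by
  obtain ⟨hb, hD⟩ := hG
  obtain ⟨r, hr, r', hr', hrr'⟩ := hS2
  have hadj := fun {x y} (h : G.Adj x y) => hb.dist_adj hc r h
  have hdesc := fun {x} (hx : x ∈ S) (hxr : x ≠ r) => hD.exists_descent hS hr hx hxr
  obtain ⟨m, hm, hmax⟩ := S.toFinite.exists_maximalFor (G.dist r) S ⟨r, hr⟩
  have hmax' : ∀ x ∈ S, G.dist r x ≤ G.dist r m := fun x hx => by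
    by_contra! h
    exact absurd (hmax hx h.le) (by omega)
  set k := G.dist r m
  have hk0 : 0 < k := (hc.pos_dist_of_ne hrr').trans_le (hmax' r' hr')
  -- Minimality of the neighborhood within the last layer serves `hnest`: a last-layer vertex
  -- missing a neighbor of `v` must have a neighbor that `v` lacks.
  obtain ⟨v, ⟨hv, hvk⟩, hmin⟩ := (Set.toFinite {x | x ∈ S ∧ G.dist r x = k}).exists_minimalFor
    (fun x => {w | w ∈ S ∧ G.Adj x w}) _ ⟨m, hm, rfl⟩
  have hne : ∀ x, 0 < G.dist r x → x ≠ r := by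
    rintro x hx rfl
    simp at hx
  -- neighbors of the last layer lie in the previous one
  have hlast : ∀ x ∈ S, G.dist r x = k → ∀ w ∈ S, G.Adj x w → G.dist r w + 1 = k := by
    intro x hx hxk w hw h
    have := hmax' w hw
    have := hadj h
    omega
  have hvr : v ≠ r := hne v (by omega)
  obtain ⟨x, hx, hvx, -⟩ := hdesc hv hvr
  have hxk := hlast v hv hvk x hx hvx
  by_cases hpend : ∀ w ∈ S, G.Adj v w → w = x
  · refine ⟨v, hv, x, hx, hvx.ne, ?_, Or.inl fun w hw => ⟨hpend w hw, fun h => h ▸ hvx⟩⟩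
    refine induce_connected_of_descent (r := r) ⟨hr, hvr.symm⟩ (G.dist r) ?_
    rintro w ⟨hw, -⟩ hwr
    obtain ⟨y, hy, hwy, hlt⟩ := hdesc hw hwr
    refine ⟨y, ⟨hy, ?_⟩, hwy, hlt⟩
    rintro rfl
    have := hmax' w hw
    omega
  push Not at hpend
  obtain ⟨y, hy, hvy, hyx⟩ := hpend
  have hyk := hlast v hv hvk y hy hvy
  have hk1 : 0 < G.dist r x := by
    by_contra! h
    have h1 : r = x := hc.dist_eq_zero_iff.1 (by omega)
    have h2 : r = y := hc.dist_eq_zero_iff.1 (by omega)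
    exact hyx (h2 ▸ h1)
  have hxr : x ≠ r := hne x hk1
  -- the low part of `S`, with connected extensions
  have hconn : ∀ U : Set V, U ⊆ S → (∀ w ∈ U, G.dist r w < k - 1 ∨ G.dist r w = k - 1 ∨
      ∃ z ∈ U, G.Adj w z ∧ G.dist r z < G.dist r w) → (∀ w ∈ S, G.dist r w < k - 1 → w ∈ U) →
      (G.induce U).Connected := by
    intro U hUS hU hlow
    refine induce_connected_of_descent (r := r) (hlow r hr (by simp; omega)) (G.dist r) ?_
    intro w hw hwr
    obtain ⟨z, hz, hwz, hlt⟩ := hdesc (hUS hw) hwr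
    rcases hU w hw with h | h | h
    · exact ⟨z, hlow z hz (by omega), hwz, hlt⟩
    · exact ⟨z, hlow z hz (by omega), hwz, hlt⟩
    · exact h
  -- The vertices `v` and `z` have the common neighbor `x`, hence also one among the layers below `k
  -- - 1` together with `y` and `v`. Neighbors of `v` in `S` lie in layer `k - 1`, so only `y` is
  -- possible.
  have hdown : ∀ x ∈ S, ∀ y ∈ S, G.Adj v x → G.Adj v y → ∀ z ∈ S, G.dist r z < k →
      G.Adj x z → G.Adj y z := by
    intro x hx y hy hvx hvy z hz hzk hxz
    have hxk := hlast v hv hvk x hx hvx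
    have hyk := hlast v hv hvk y hy hvy
    have hzk' := hadj hxz
    obtain ⟨t, ht, hvt, htz⟩ := hD.exists_common_adj
      (T := {w | w ∈ S ∧ G.dist r w < k - 1} ∪ {y, v}) (u := v) (v := z) (x := x)
      (hconn _ (by rintro w (hw | rfl | rfl) <;> [exact hw.1; exact hy; exact hv])
        (by
          rintro w (hw | rfl | rfl)
          · exact Or.inl hw.2
          · exact Or.inr (Or.inl (by omega))
          · exact Or.inr (Or.inr ⟨y, by simp, hvy, by omega⟩))
        (fun w hw h => Or.inl ⟨hw, h⟩))
      (by simp) (Or.inl ⟨hz, by omega⟩) (by rintro rfl; omega)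
      (fun h => by have := hadj h; omega) hvx hxz
    rcases ht with ht | rfl | rfl
    · have := hlast v hv hvk t ht.1 hvt
      have := ht.2
      omega
    · exact htz
    · exact absurd hvt (G.loopless.irrefl _)
  -- If `w` misses `y`, minimality gives `w` a neighbor `y'` not adjacent to `v`. The low layers
  -- with `y, y', v, w` are then connected but contain no common neighbor of `v` and `w`, although
  -- `x` is one in `G`.
  have hnest : ∀ x ∈ S, ∀ y ∈ S, G.Adj v x → G.Adj v y → ∀ w ∈ S, G.dist r w = k →
      G.Adj x w → G.Adj y w := by
    intro x hx y hy hvx hvy w hw hwk hxw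
    by_contra hyw
    have hyk := hlast v hv hvk y hy hvy
    have hvw : v ≠ w := by
      rintro rfl
      exact hyw hvy.symm
    obtain ⟨y', hy', hwy', hvy'⟩ : ∃ y' ∈ S, G.Adj w y' ∧ ¬ G.Adj v y' := by
      by_contra! h
      have hsub : {z | z ∈ S ∧ G.Adj w z} ⊆ {z | z ∈ S ∧ G.Adj v z} :=
        fun z hz => ⟨hz.1, h z hz.1 hz.2⟩
      exact hyw (hmin (j := w) ⟨hw, hwk⟩ hsub ⟨hy, hvy⟩).2.symm
    have hyk' := hlast w hw hwk y' hy' hwy'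
    obtain ⟨t, ht, hvt, htw⟩ := hD.exists_common_adj
      (T := {z | z ∈ S ∧ G.dist r z < k - 1} ∪ {y, y', v, w}) (u := v) (v := w) (x := x)
      (hconn _ (by
          rintro z (hz | rfl | rfl | rfl | rfl) <;>
            [exact hz.1; exact hy; exact hy'; exact hv; exact hw])
        (by
          rintro z (hz | rfl | rfl | rfl | rfl)
          · exact Or.inl hz.2
          · exact Or.inr (Or.inl (by omega))
          · exact Or.inr (Or.inl (by omega))
          · exact Or.inr (Or.inr ⟨y, by simp, hvy, by omega⟩)
          · exact Or.inr (Or.inr ⟨y', by simp, hwy', by omega⟩))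
        (fun w hw h => Or.inl ⟨hw, h⟩))
      (by simp) (by simp) hvw (fun h => by have := hadj h; omega) hvx hxw
    rcases ht with ht | rfl | rfl | rfl | rfl
    · have := hlast v hv hvk t ht.1 hvt
      have := ht.2
      omega
    · exact hyw htw
    · exact hvy' hvt
    · exact absurd hvt (G.loopless.irrefl _)
    · exact absurd htw (G.loopless.irrefl _)
  have htwin : ∀ x ∈ S, ∀ y ∈ S, G.Adj v x → G.Adj v y → ∀ w ∈ S, G.Adj x w → G.Adj y w := by
    intro x hx y hy hvx hvy w hw hxw
    rcases (hmax' w hw).lt_or_eq with h | h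
    · exact hdown x hx y hy hvx hvy w hw h hxw
    · exact hnest x hx y hy hvx hvy w hw h hxw
  -- The vertex deleted is `x`, not `v`; its twin `y` lies in the same layer and replaces it in
  -- every descent.
  refine ⟨x, hx, y, hy, hyx.symm, ?_, Or.inr ⟨⟨v, hv, hvy.symm, hvx.symm⟩, fun w hw =>
    ⟨htwin x hx y hy hvx hvy w hw, htwin y hy x hx hvy hvx w hw⟩⟩⟩
  refine induce_connected_of_descent (r := r) ⟨hr, hxr.symm⟩ (G.dist r) ?_
  rintro w ⟨hw, -⟩ hwr
  obtain ⟨z, hz, hwz, hlt⟩ := hdesc hw hwr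
  by_cases hzx : z = x
  · subst hzx
    exact ⟨y, ⟨hy, hyx⟩, (htwin z hz y hy hvx hvy w hw hwz.symm).symm, by omega⟩
  · exact ⟨z, ⟨hz, hzx⟩, hwz, hlt⟩

end SimpleGraph
-- Growing the path forest
/-- A set version of an arborescence representation of `G[S]` on the color class `A`: the elements
of `A ∩ S` form a rooted forest with parent function `p`, in which the neighborhood of every
vertex of `B ∩ S` is a directed path. -/
def HasPathForest {V : Type*} (G : SimpleGraph V) (A B S : Set V) : Prop :=
  ∃ (p : V → Option V) (f : V → ℕ),
    (∀ x y, p x = some y → y ∈ A ∧ y ∈ S ∧ f y < f x) ∧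
    ∀ b ∈ B, b ∈ S → ∃ l : List V, l.IsChain (fun x y => p y = some x) ∧
      ∀ x, x ∈ l ↔ G.Adj b x ∧ x ∈ S

namespace HasPathForest

open Function

variable {V : Type*} {G : SimpleGraph V} {A B S : Set V}

theorem pairwise_of_isChain {p : V → Option V} {f : V → ℕ}
    (hp : ∀ x y, p x = some y → f y < f x) {l : List V}
    (hl : l.IsChain (fun x y => p y = some x)) : l.Pairwise (fun x y => f x < f y) := by
  have : Trans (fun x y => f x < f y) (fun x y => f x < f y) (fun x y => f x < f y) :=
    ⟨fun h h' => h.trans h'⟩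
  exact List.isChain_iff_pairwise.1 (hl.imp fun a b h => hp b a h)

theorem nodup_of_isChain {p : V → Option V} {f : V → ℕ}
    (hp : ∀ x y, p x = some y → f y < f x) {l : List V}
    (hl : l.IsChain (fun x y => p y = some x)) : l.Nodup :=
  (pairwise_of_isChain hp hl).imp fun h he => by simp [he] at h

theorem singleton (v : V) : HasPathForest G A B {v} := by
  refine ⟨fun _ => none, fun _ => 0, by simp, ?_⟩
  rintro b - rfl
  refine ⟨[], .nil, fun x => ?_⟩
  simp only [List.not_mem_nil, Set.mem_singleton_iff, false_iff, not_and]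
  rintro h rfl
  exact G.loopless.irrefl _ h

/-- A new vertex of `B` whose neighborhood is a directed path can be added. -/
theorem insert_right (hAB : G.IsBipartiteWith A B) (h : HasPathForest G A B S) {v : V}
    (hv : v ∈ B)
    (hl : ∀ p : V → Option V, (∀ b ∈ B, b ∈ S → ∃ l : List V, l.IsChain (fun x y => p y = some x) ∧
      ∀ x, x ∈ l ↔ G.Adj b x ∧ x ∈ S) → ∃ l : List V, l.IsChain (fun x y => p y = some x) ∧
      ∀ x, x ∈ l ↔ G.Adj v x ∧ x ∈ S) : HasPathForest G A B (insert v S) := by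
  obtain ⟨p, f, hp, hB⟩ := h
  refine ⟨p, f, fun x y hxy => ⟨(hp x y hxy).1, Or.inr (hp x y hxy).2.1, (hp x y hxy).2.2⟩, ?_⟩
  intro b hb hbS
  have hnadj : ¬ G.Adj b v := fun h => by
    rcases hAB.mem_of_adj h with h | h
    · exact Set.disjoint_left.1 hAB.disjoint h.1 hb
    · exact Set.disjoint_left.1 hAB.disjoint h.2 hv
  obtain ⟨l, hl, hlx⟩ : ∃ l : List V, l.IsChain (fun x y => p y = some x) ∧
      ∀ x, x ∈ l ↔ G.Adj b x ∧ x ∈ S := by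
    rcases hbS with rfl | hbS
    · exact hl p hB
    · exact hB b hb hbS
  refine ⟨l, hl, fun x => ?_⟩
  rw [hlx, Set.mem_insert_iff]
  constructor
  · exact fun h => ⟨h.1, Or.inr h.2⟩
  · rintro ⟨h, rfl | h'⟩
    · exact absurd h hnadj
    · exact ⟨h, h'⟩

open Classical in
-- The vertex `v` becomes a leaf below the end of the path of `u`, or a new root if that path is
-- empty. No other path changes, since `u` is the only neighbor of `v` in `S`.
theorem insert_pendant_left (hAB : G.IsBipartiteWith A B) (h : HasPathForest G A B S) {u v : V}
    (hv : v ∈ A) (hvS : v ∉ S) (hu : u ∈ B) (huS : u ∈ S) (huv : ∀ w ∈ S, G.Adj v w ↔ w = u) :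
    HasPathForest G A B (insert v S) := by
  obtain ⟨p, f, hp, hB⟩ := h
  obtain ⟨l, hl, hlx⟩ := hB u hu huS
  have hvB : v ∉ B := Set.disjoint_left.1 hAB.disjoint hv
  have hchain : ∀ (o : Option V) (l : List V), (∀ x ∈ l, x ∈ S) →
      l.IsChain (fun x y => p y = some x) →
      l.IsChain (fun x y => update p v o y = some x) := by
    intro o l hlS hl
    refine List.IsChain.imp_of_mem_imp ?_ hl
    intro x y _ hy h
    rwa [update_of_ne]
    rintro rfl
    exact hvS (hlS _ hy)
  refine ⟨update p v l.getLast?, update f v (1 + (l.getLast?.elim 0 f)), ?_, ?_⟩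
  · intro x y hxy
    by_cases hx : x = v
    · subst hx
      rw [update_self] at hxy
      have hy := (hlx y).1 (List.mem_of_getLast? hxy)
      refine ⟨?_, Or.inr hy.2, ?_⟩
      · rcases hAB.mem_of_adj hy.1 with h | h
        · exact absurd hu (Set.disjoint_left.1 hAB.disjoint h.1)
        · exact h.2
      · rw [update_self, update_of_ne (by rintro rfl; exact hvS hy.2), hxy]
        simp
    · rw [update_of_ne hx] at hxy
      obtain ⟨hy, hyS, hlt⟩ := hp x y hxy
      refine ⟨hy, Or.inr hyS, ?_⟩
      rwa [update_of_ne hx, update_of_ne (by rintro rfl; exact hvS hyS)]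
  · intro b hb hbS
    replace hbS : b ∈ S := hbS.resolve_left (by rintro rfl; exact hvB hb)
    by_cases hbu : b = u
    · subst hbu
      refine ⟨l ++ [v], ?_, fun x => ?_⟩
      · rw [List.isChain_append]
        refine ⟨hchain _ l (fun x hx => ((hlx x).1 hx).2) hl, .singleton _, ?_⟩
        intro x hx y hy
        simp only [List.head?_cons, Option.mem_def, Option.some.injEq] at hy
        subst hy
        rwa [update_self]
      · have := (huv b huS).2 rfl
        simp only [List.mem_append, hlx, List.mem_singleton, Set.mem_insert_iff]
        constructor
        · rintro (h | rfl)
          · exact ⟨h.1, Or.inr h.2⟩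
          · exact ⟨this.symm, Or.inl rfl⟩
        · rintro ⟨h, rfl | h'⟩
          · exact Or.inr rfl
          · exact Or.inl ⟨h, h'⟩
    · obtain ⟨m, hm, hmx⟩ := hB b hb hbS
      refine ⟨m, hchain _ m (fun x hx => ((hmx x).1 hx).2) hm, fun x => ?_⟩
      rw [hmx, Set.mem_insert_iff]
      constructor
      · exact fun h => ⟨h.1, Or.inr h.2⟩
      · rintro ⟨h, rfl | h'⟩
        · exact absurd ((huv b hbS).1 h.symm) hbu
        · exact ⟨h, h'⟩

open Classical in
-- The twin `v` becomes the only child of `u` and takes over the former children of `u`. A path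
-- through `u` then runs through `u, v` consecutively; a path avoiding `u` is unaffected.
theorem insert_twin_left (hAB : G.IsBipartiteWith A B) (h : HasPathForest G A B S) {u v : V}
    (hv : v ∈ A) (hvS : v ∉ S) (hu : u ∈ A) (huS : u ∈ S)
    (huv : ∀ w ∈ S, G.Adj v w ↔ G.Adj u w) : HasPathForest G A B (insert v S) := by
  obtain ⟨p, f, hp, hB⟩ := h
  have hvB : v ∉ B := Set.disjoint_left.1 hAB.disjoint hv
  have huv' : u ≠ v := by
    rintro rfl
    exact hvS huS
  set q : V → Option V := fun x => if x = v then some u else if p x = some u then some v else p x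
    with hq
  have hqv : q v = some u := by simp [hq]
  have hchain : ∀ l : List V, (∀ x ∈ l, x ∈ S ∧ x ≠ u) → l.IsChain (fun x y => p y = some x) →
      l.IsChain (fun x y => q y = some x) := by
    intro l hlS hl
    refine List.IsChain.imp_of_mem_imp ?_ hl
    intro x y hx hy h
    have h1 : y ≠ v := by
      rintro rfl
      exact hvS (hlS _ hy).1
    simp [hq, h1, h, (hlS x hx).2]
  -- Doubling makes room for `v` strictly between `u` and its former children.
  refine ⟨q, fun x => if x = v then 2 * f u + 1 else 2 * f x, ?_, ?_⟩
  · intro x y hxy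
    by_cases hx : x = v
    · subst hx
      obtain rfl : u = y := by simpa [hqv] using hxy
      simp [hu, huS, huv']
    · by_cases hx' : p x = some u
      · obtain rfl : v = y := by simpa [hq, hx, hx'] using hxy
        have := (hp x u hx').2.2
        simp only [hv, Set.mem_insert_iff, true_or, if_true, if_neg hx, true_and]
        omega
      · have hxy : p x = some y := by simpa [hq, hx, hx'] using hxy
        obtain ⟨hy, hyS, hlt⟩ := hp x y hxy
        have hyv : y ≠ v := by
          rintro rfl
          exact hvS hyS
        simp [hx, hyv, hy, hyS, hlt]
  · intro b hb hbS
    replace hbS : b ∈ S := hbS.resolve_left (by rintro rfl; exact hvB hb)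
    obtain ⟨l, hl, hlx⟩ := hB b hb hbS
    by_cases hul : u ∈ l
    · have hbv : G.Adj b v := ((huv b hbS).2 ((hlx u).1 hul).1.symm).symm
      -- A path has no repetition, so `u` lies in neither `l₁` nor `l₂`; of their parent links only
      -- that of the head of `l₂` changes, from `u` to `v`.
      obtain ⟨l₁, l₂, rfl⟩ := List.append_of_mem hul
      have hnd := nodup_of_isChain (fun x y h => (hp x y h).2.2) hl
      refine ⟨l₁ ++ u :: v :: l₂, ?_, fun x => ?_⟩
      · have hS : ∀ x ∈ l₁ ++ u :: l₂, x ∈ S := fun x hx => ((hlx x).1 hx).2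
        rw [List.isChain_append] at hl ⊢
        obtain ⟨h₁, h₂, h₁₂⟩ := hl
        rw [List.nodup_append] at hnd
        obtain ⟨-, hnd₂, hnd⟩ := hnd
        rw [List.nodup_cons] at hnd₂
        refine ⟨hchain l₁ (fun x hx => ⟨hS x (by simp [hx]), hnd x hx u (by simp)⟩) h₁, ?_, ?_⟩
        · rw [List.isChain_cons_cons]
          refine ⟨hqv, ?_⟩
          have h₂' := hchain l₂ (fun x hx => ⟨hS x (by simp [hx]), fun h => hnd₂.1 (h ▸ hx)⟩)
            h₂.tail
          rw [List.isChain_cons] at h₂ ⊢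
          refine ⟨fun y hy => ?_, h₂'⟩
          have hyv : y ≠ v := by
            rintro rfl
            exact hvS (hS _ (by simp [List.mem_of_mem_head? hy]))
          simp [hq, hyv, h₂.1 y hy]
        · intro x hx y hy
          obtain rfl : u = y := by simpa using hy
          have h := h₁₂ x hx u (by simp)
          have hxu : x ≠ u := hnd x (List.mem_of_mem_getLast? hx) u (by simp)
          simp [hq, huv', h, hxu]
      · have hx := hlx x
        simp only [List.mem_append, List.mem_cons, Set.mem_insert_iff] at hx ⊢
        by_cases hxv : x = v
        · subst hxv
          simp [hbv]
        · simp only [hxv, false_or]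
          exact hx
    · refine ⟨l, hchain l (fun x hx => ⟨((hlx x).1 hx).2, fun h => hul (h ▸ hx)⟩) hl, fun x => ?_⟩
      rw [hlx, Set.mem_insert_iff]
      constructor
      · exact fun h => ⟨h.1, Or.inr h.2⟩
      · rintro ⟨h, rfl | h'⟩
        · exact absurd ((hlx u).2 ⟨((huv b hbS).1 h.symm).symm, huS⟩) hul
        · exact ⟨h, h'⟩

/-- Connected induced subgraphs of a connected bipartite distance hereditary graph are
represented by paths in a rooted forest. -/
theorem of_isBDH [Finite V] (hc : G.Connected) (hG : IsBDH G) (hAB : AreColorClasses G A B) :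
    ∀ S : Set V, (G.induce S).Connected → HasPathForest G A B S := by
  obtain ⟨hcompl, hAB⟩ := hAB
  have hcases : ∀ v, v ∈ A ∨ v ∈ B := fun v => by
    have : v ∈ A ⊔ B := by
      rw [hcompl.sup_eq_top]
      trivial
    exact this
  have hopp : ∀ {x y}, G.Adj x y → (x ∈ A → y ∈ B) ∧ (x ∈ B → y ∈ A) := by
    intro x y h
    have hd : ∀ z, z ∈ A → z ∉ B := fun z hz => Set.disjoint_left.1 hAB.disjoint hz
    rcases hAB.mem_of_adj h with ⟨h1, h2⟩ | ⟨h1, h2⟩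
    · exact ⟨fun _ => h2, fun h => absurd h (hd _ h1)⟩
    · exact ⟨fun h => absurd h1 (hd _ h), fun _ => h2⟩
  have key : ∀ n, ∀ S : Set V, S.ncard = n → (G.induce S).Connected → HasPathForest G A B S := by
    intro n
    induction n with
    | zero =>
      intro S hS hSc
      rw [Set.ncard_eq_zero] at hS
      obtain ⟨x, hx⟩ := hSc.nonempty
      simp [hS] at hx
    | succ n ih =>
      intro S hS hSc
      by_cases hS2 : S.Nontrivial
      · obtain ⟨v, hv, u, hu, hvu, hSv, h⟩ := hG.exists_pendant_or_twin hc hSc hS2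
        have hIH := ih (S \ {v}) (by rw [Set.ncard_sdiff_singleton_of_mem hv]; omega) hSv
        have hvS : v ∉ S \ {v} := by simp
        have huS : u ∈ S \ {v} := ⟨hu, hvu.symm⟩
        rw [← Set.insert_sdiff_self_of_mem hv]
        rcases h with h | ⟨⟨t, ht, hut, hvt⟩, h⟩
        · have hadj : G.Adj v u := (h u hu).2 rfl
          rcases hcases v with hvA | hvB
          · exact insert_pendant_left hAB hIH hvA hvS ((hopp hadj).1 hvA) huS
              fun w hw => h w hw.1
          · refine insert_right hAB hIH hvB fun p _ => ⟨[u], .singleton _, fun x => ?_⟩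
            rw [List.mem_singleton]
            constructor
            · rintro rfl
              exact ⟨hadj, huS⟩
            · exact fun hx => (h x hx.2.1).1 hx.1
        -- The common neighbor `t` puts the twins in the same color class.
        · rcases hcases v with hvA | hvB
          · have huA : u ∈ A := (hopp hut.symm).2 ((hopp hvt).1 hvA)
            exact insert_twin_left hAB hIH hvA hvS huA huS fun w hw => h w hw.1
          · have huB : u ∈ B := (hopp hut.symm).1 ((hopp hvt).2 hvB)
            refine insert_right hAB hIH hvB fun p hp => ?_
            obtain ⟨l, hl, hlx⟩ := hp u huB huS
            refine ⟨l, hl, fun x => ?_⟩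
            rw [hlx]
            exact and_congr_left fun hx => (h x hx.1).symm
      · obtain ⟨x, hx⟩ := hSc.nonempty
        rw [Set.not_nontrivial_iff] at hS2
        rw [hS2.eq_singleton_of_mem hx]
        exact singleton x
  exact fun S => key _ S rfl

end HasPathForest

/-! ### From path forests to arborescences and circuits -/

/-- A sequence of arcs, each ending where the next one starts, starting at `s`. -/
theorem List.map_src_append {E W : Type*} (src tgt : E → W) (l : List E) (s : W)
    (hl : l.IsChain (fun x y => tgt x = src y)) (hs : ∀ x ∈ l.head?, src x = s) :
    l.map src ++ [(s :: l.map tgt).getLast (by simp)] = s :: l.map tgt := by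
  induction l generalizing s with
  | nil => simp
  | cons a l ih =>
    rw [List.isChain_cons] at hl
    have := ih (tgt a) hl.2 fun x hx => (hl.1 x hx).symm
    simp only [List.map_cons, List.cons_append, List.getLast_cons_cons] at this ⊢
    rw [this, hs a (by simp)]

/-- A directed path from `s` that visits no vertex twice, closed by the arc `b`, is a directed
circuit. -/
theorem isDirectedCircuit_of_isChain {E W : Type*} (src tgt : E → W) (l : List E) (b : E)
    (hl : l.IsChain (fun x y => tgt x = src y)) (hs : ∀ x ∈ l.head?, src x = tgt b)
    (hb : src b = (tgt b :: l.map tgt).getLast (by simp)) (hnd : (tgt b :: l.map tgt).Nodup) :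
    IsDirectedCircuit src tgt ({b} ∪ {x | x ∈ l}) := by
  -- With `b` listed last, the sources of the arcs are exactly the vertices of the path, so `hnd`
  -- gives injectivity.
  have hmap : (l ++ [b]).map src = tgt b :: l.map tgt := by
    rw [List.map_append, List.map_singleton, hb]
    exact List.map_src_append src tgt l _ hl hs
  have hlen : (l ++ [b]).length = l.length + 1 := by simp
  have hsrc : ∀ (i : ℕ) (hi : i < (l ++ [b]).length),
      src (l ++ [b])[i] = (tgt b :: l.map tgt)[i]'(by simpa using hi) := by
    intro i hi
    rw [← List.getElem_map src (h := by simpa using hi)]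
    simp only [hmap]
  refine ⟨l.length, fun i => (l ++ [b])[(i : ℕ)]'(by omega), ?_, ?_, ?_⟩
  · intro i j hij
    simp only [hsrc] at hij
    exact Fin.ext ((hnd.getElem_inj_iff).1 hij)
  · intro i
    rw [hsrc]
    induction i using Fin.lastCases with
    | last => simp
    | cast i => simp [Fin.coeSucc_eq_succ]
  · ext x
    simp only [Set.mem_range, Set.mem_union, Set.mem_singleton_iff, Set.mem_ofPred_eq]
    have : x ∈ l ++ [b] ↔ x = b ∨ x ∈ l := by simp [or_comm]
    rw [← this, List.mem_iff_getElem]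
    constructor
    · rintro ⟨i, hi⟩
      exact ⟨i, by omega, hi⟩
    · rintro ⟨i, hi, h⟩
      exact ⟨⟨i, by simpa using hi⟩, h⟩

namespace HasPathForest

variable {V : Type*} {G : SimpleGraph V} {A B : Set V}

theorem isPathArborescenceOn [Finite V] (hAB : G.IsBipartiteWith A B)
    (h : HasPathForest G A B Set.univ) : IsPathArborescenceOn G A B := by
  classical
  obtain ⟨p, f, hp, hB⟩ := h
  choose! l hl hlx using hB
  -- The arborescence must live in `Type`, so `A` is replaced by `Fin m`; `none` will be the added
  -- root.
  obtain ⟨m, ⟨e⟩⟩ := Finite.exists_equiv_fin A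
  set node : V → Option (Fin m) := fun x => if hx : x ∈ A then some (e ⟨x, hx⟩) else none with hnode
  set par : V → Option (Fin m) := fun x => (p x).bind node with hpar
  have hnodeA : ∀ a : A, node a = some (e a) := fun a => by simp [hnode]
  have hnode' : ∀ i, node (e.symm i) = some i := fun i => by simp [hnodeA]
  have hparA : ∀ x y, p x = some y → par x = node y := fun x y h => by simp [hpar, h]
  let Q : Quiver.{0} (Option (Fin m)) :=
    ⟨fun x y => {i : Fin m // x = par (e.symm i) ∧ y = some i}⟩
  -- Height increases along every arc; this gives both the arborescence and the distinctness of the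
  -- vertices on each circuit.
  set height : Option (Fin m) → ℕ := fun o => o.elim 0 fun i => f (e.symm i) + 1 with hheight
  have hheight_node : ∀ x ∈ A, height (node x) = f x + 1 := fun x hx => by
    simp [hheight, hnodeA ⟨x, hx⟩]
  have hheight_par : ∀ x, height (par x) ≤ f x := fun x => by
    cases hx : p x with
    | none => simp [hpar, hx, hheight]
    | some y =>
      obtain ⟨hy, -, hlt⟩ := hp x y hx
      rw [hparA x y hx, hheight_node y hy]
      exact hlt
  let T : Quiver.Arborescence (Option (Fin m)) := Quiver.arborescenceMk none height
    (by
      rintro _ _ ⟨i, rfl, rfl⟩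
      exact Nat.lt_succ_of_le (hheight_par _))
    (by
      rintro _ _ _ ⟨i, rfl, rfl⟩ ⟨j, rfl, hj⟩
      obtain rfl : i = j := by simpa using hj
      exact ⟨rfl, HEq.rfl⟩)
    (by
      rintro (_ | i)
      · exact Or.inl rfl
      · exact Or.inr ⟨_, ⟨⟨i, rfl, rfl⟩⟩⟩)
  let ξ : A ≃ Quiver.Total (Option (Fin m)) :=
    e.trans
      { toFun := fun i => ⟨par (e.symm i), some i, ⟨i, rfl, rfl⟩⟩
        invFun := fun t => t.hom.1
        left_inv := fun _ => rfl
        right_inv := by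
          rintro ⟨_, _, ⟨i, rfl, rfl⟩⟩
          rfl }
  -- A vertex of `B` runs from the end of its path back to the start; with an empty neighborhood it
  -- is a loop at the root.
  set tgt : V → Option (Fin m) := fun x => if x ∈ A then node x else (l x).head?.bind par with htgt
  set src : V → Option (Fin m) := fun x => if x ∈ A then par x else
    (tgt x :: (l x).map tgt).getLast (by simp) with hsrc
  refine ⟨Option (Fin m), Q, T, ξ, src, tgt, fun a => ⟨?_, ?_⟩, fun b hb => ?_⟩
  · simp [hsrc, ξ]
  · simp [htgt, ξ, hnodeA]
  have hbA : b ∉ A := fun h => Set.disjoint_left.1 hAB.disjoint h hb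
  have hlA : ∀ x ∈ l b, x ∈ A := fun x hx => by
    rcases hAB.mem_of_adj ((hlx b hb trivial x).1 hx).1 with h | h
    · exact absurd h.1 hbA
    · exact h.2
  have hnb : G.neighborSet b = {x | x ∈ l b} := by
    ext x
    simp [hlx b hb trivial]
  have htgtA : ∀ x ∈ A, tgt x = node x := fun x hx => if_pos hx
  have hsrcA : ∀ x ∈ A, src x = par x := fun x hx => if_pos hx
  have htb : tgt b = (l b).head?.bind par := if_neg hbA
  rw [hnb]
  refine isDirectedCircuit_of_isChain src tgt (l b) b ?_ ?_ (if_neg hbA) ?_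
  · refine List.IsChain.imp_of_mem_imp ?_ (hl b hb trivial)
    intro x y hx hy hxy
    rw [htgtA x (hlA x hx), hsrcA y (hlA y hy), hparA y x hxy]
  · intro x hx
    rw [hsrcA x (hlA x (List.mem_of_mem_head? hx)), htb, hx]
    rfl
  · have hpw := pairwise_of_isChain (fun x y h => (hp x y h).2.2) (hl b hb trivial)
    have hle : ∀ x ∈ l b, height (tgt b) < height (tgt x) := by
      intro x hx
      rw [htgtA x (hlA x hx), hheight_node x (hlA x hx), htb]
      cases hlb : l b with
      | nil => simp [hlb] at hx
      | cons a t =>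
        rw [hlb] at hpw hx
        have h1 := hheight_par a
        rcases List.mem_cons.1 hx with rfl | hx
        · exact Nat.lt_succ_of_le h1
        · have := List.rel_of_pairwise_cons hpw hx
          simp only [List.head?_cons, Option.bind_some]
          omega
    rw [List.nodup_cons]
    refine ⟨fun h => ?_, ?_⟩
    · obtain ⟨x, hx, hxb⟩ := List.mem_map.1 h
      exact absurd (hle x hx) (by rw [hxb]; exact lt_irrefl _)
    · refine List.pairwise_map.2 (List.Pairwise.imp_of_mem ?_ hpw)
      intro x y hx hy hxy he
      have := congrArg height he
      rw [htgtA x (hlA x hx), htgtA y (hlA y hy), hheight_node x (hlA x hx),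
        hheight_node y (hlA y hy)] at this
      omega

end HasPathForest

theorem IsBDH.isPathArborescenceOn {V : Type*} [Finite V] {G : SimpleGraph V} {A B : Set V}
    (hc : G.Connected) (hG : IsBDH G) (hAB : AreColorClasses G A B) :
    IsPathArborescenceOn G A B :=
  (HasPathForest.of_isBDH hc hG hAB Set.univ
    ((SimpleGraph.induceUnivIso G).connected_iff.2 hc)).isPathArborescenceOn hAB.2

theorem mainTheorem4 {V : Type*} [Finite V] (G : SimpleGraph V) (hconn : G.Connected)
    (hG : IsBDH G) : IsSelfDualPathArborescence G := by
  exact ⟨hG.1, fun A B hAB => ⟨hG.isPathArborescenceOn hconn hAB,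
    hG.isPathArborescenceOn hconn ⟨hAB.1.symm, hAB.2.symm⟩⟩⟩
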